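/- Let $G$ be a finite connected multigraph (loops and multiple edges allowed) that remains connected after the removal of any one edge, and fix an orientation of its edges. Let $\mathcal F(G)\subset\mathbb Z^{E(G)}$ be the lattice of integer flows (the elements whose incoming and outgoing totals agree at every vertex), with the pairing $(x,y)=\sum_{e}x_ey_e$. An oriented circuit is a closed walk that repeats no vertex and no edge; it defines a circuit element of $\mathcal F(G)$ whose coefficients are $+1$ or $-1$ on its edges (according to whether an edge is traversed along or against its orientation) and $0$ elsewhere. Let $\mathcal B=\{C_1,\dots,C_r\}$ be a basis of $\mathcal F(G)$ that consists of circuit elements and is cancellation-free, that is, $|C_i\cap C_j|=|(C_i,C_j)|$ for all $i\ne j$, where $C_i\cap C_j$ is the set of common edges. Let $V(G)$ be the Voronoi cell of $\mathcal F(G)$, i.e. the set of points of the real span $\mathcal F(G)\otimes\mathbb R\subset\mathbb R^{E(G)}$ that are at least as close to $0$ as to any other point of $\mathcal F(G)$. For a circuit element $C$ let $F_C=\{x\in V(G):(x,C)=(C,C)/2\}$. An edge of $V(G)$ is a one-dimensional face (the cell itself, if it is one-dimensional), and $[\epsilon]$ denotes the class of all edges of $V(G)$ parallel to the edge $\epsilon$.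 Write $[\epsilon]\notin F_C$ if no edge in the class $[\epsilon]$ is contained in $F_C$. Let $S_{[\epsilon]}\subset E(G)$ be the set of edges of $G$ that lie in no circuit $C$ for which $F_C$ contains an edge in the class $[\epsilon]$. The 2-cut blocks of $G$ are the classes of the relation "$e=f$, or $e\neq f$ and $G-\{e,f\}$ is disconnected" on $E(G)$. Then there are finitely many parallel classes $[\epsilon]$, and $[\epsilon]\mapsto S_{[\epsilon]}$ is a bijection from the parallel classes of edges of $V(G)$ onto the 2-cut blocks of $G$. Moreover, the system of linear equations $$\sum_{[\epsilon]\notin F_{C_i}}n_{[\epsilon]}=(C_i,C_i)\qquad(1\le i\le r),$$ $$\sum_{[\epsilon]\notin F_{C_i},\ [\epsilon]\notin F_{C_j}}n_{[\epsilon]}=|(C_i,C_j)|\qquad(1\le i,j\le r,\ i\neq j)$$ in the unknowns $n_{[\epsilon]}$, one for each parallel class, has exactly one solution in positive integers, namely $n_{[\epsilon]}=|S_{[\epsilon]}|$. -/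

import Mathlib

open scoped Graph

namespace Graph

/-- A multigraph is connected if it has a vertex and any two vertices are joined by a walk. -/
def IsConnected {α β : Type*} (G : Graph α β) : Prop :=
  V(G).Nonempty ∧ ∀ u ∈ V(G), ∀ v ∈ V(G), Relation.ReflTransGen G.Adj u v

/-- `G` is connected and remains connected after removing any one edge. -/
def IsTwoEdgeConnected {α β : Type*} (G : Graph α β) : Prop :=
  G.IsConnected ∧ ∀ e ∈ E(G), (G.deleteEdges {e}).IsConnected

/-- A 2-cut: two distinct edges whose joint removal disconnects `G`. -/
def IsTwoCut {α β : Type*} (G : Graph α β) (e f : E(G)) : Prop :=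
  e ≠ f ∧ ¬ (G.deleteEdges {e.1, f.1}).IsConnected

/-- The 2-cut blocks: the classes of the relation "equal or forming a 2-cut" on the edges. -/
def IsTwoCutBlock {α β : Type*} (G : Graph α β) (S : Set E(G)) : Prop :=
  ∃ e : E(G), S = {f | e = f ∨ G.IsTwoCut e f}

/-- An orientation of a multigraph: every edge is given a direction. -/
structure Orientation {α β : Type*} (G : Graph α β) where
  tail : E(G) → α
  head : E(G) → α
  isLink : ∀ e : E(G), G.IsLink e.1 (tail e) (head e)

namespace Orientation

open Classical in
/-- The integer flows: elements of `ℤ^E(G)` whose incoming and outgoing totals agree at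
every vertex. -/
noncomputable def flowLattice {α β : Type*} {G : Graph α β} [Fintype E(G)] (ω : G.Orientation) :
    Submodule ℤ (E(G) → ℤ) where
  carrier := {a | ∀ v ∈ V(G),
    (∑ e : E(G) with ω.head e = v, a e) - (∑ e : E(G) with ω.tail e = v, a e) = 0}
  zero_mem' := by
    intro v _
    simp
  add_mem' := by
    intro a b ha hb v hv
    have h1 := ha v hv
    have h2 := hb v hv
    simp only [Pi.add_apply, Finset.sum_add_distrib]
    linarith
  smul_mem' := by
    intro k a ha v hv
    have h1 := ha v hv
    simp only [Pi.smul_apply, ← Finset.smul_sum, ← smul_sub, h1, smul_zero]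

/-- The Euclidean pairing on `ℤ^E(G)`. -/
def pairing {α β : Type*} {G : Graph α β} [Fintype E(G)] (x y : E(G) → ℤ) : ℤ :=
  ∑ e : E(G), x e * y e

/-- An oriented circuit: a closed walk of length `n + 1` (indices are cyclic) that does not repeat
a vertex or an edge. The field `forward` says whether an edge is traversed along its orientation;
a loop may be traversed in either way. -/
structure OrientedCircuit {α β : Type*} {G : Graph α β} (ω : G.Orientation) where
  n : ℕ
  vert : Fin (n + 1) → α
  edge : Fin (n + 1) → E(G)
  forward : Fin (n + 1) → Prop
  vert_injective : Function.Injective vert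
  edge_injective : Function.Injective edge
  step_forward : ∀ i, forward i → ω.tail (edge i) = vert i ∧ ω.head (edge i) = vert (i + 1)
  step_backward : ∀ i, ¬ forward i → ω.head (edge i) = vert i ∧ ω.tail (edge i) = vert (i + 1)

open Classical in
/-- The element of `ℤ^E(G)` given by an oriented circuit. -/
noncomputable def OrientedCircuit.toFlow {α β : Type*} {G : Graph α β} {ω : G.Orientation}
    (C : ω.OrientedCircuit) : E(G) → ℤ :=
  fun e => ∑ i, if C.edge i = e then (if C.forward i then 1 else -1) else 0

/-- The circuit elements of the lattice of integer flows. -/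
def IsCircuitElement {α β : Type*} {G : Graph α β} (ω : G.Orientation) (x : E(G) → ℤ) : Prop :=
  ∃ C : ω.OrientedCircuit, C.toFlow = x

/-- A circuit basis consists of circuit elements only. -/
def IsCircuitBasis {α β : Type*} {G : Graph α β} [Fintype E(G)] {ω : G.Orientation} {r : ℕ}
    (b : Module.Basis (Fin r) ℤ ω.flowLattice) : Prop :=
  ∀ i, ω.IsCircuitElement (b i).1

/-- A circuit basis is cancellation-free if, for any two basis circuits, the number of their common
edges is the absolute value of their pairing. (The edges of a circuit are the support of its
circuit element.) -/
def IsCancellationFree {α β : Type*} {G : Graph α β} [Fintype E(G)] {ω : G.Orientation} {r : ℕ}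
    (b : Module.Basis (Fin r) ℤ ω.flowLattice) : Prop :=
  ∀ i j, i ≠ j →
    ((Function.support (b i).1 ∩ Function.support (b j).1).ncard : ℤ)
      = |pairing (b i).1 (b j).1|

/-- The inclusion of `ℤ^E(G)` in Euclidean space `ℝ^E(G)`. -/
def toEuclidean {α β : Type*} {G : Graph α β} (x : E(G) → ℤ) : EuclideanSpace ℝ E(G) :=
  WithLp.toLp 2 (fun e => (x e : ℝ))

/-- The Voronoi cell of the lattice of integer flows: the points of the real span of the lattice
that are at least as close to the origin as to any other lattice point. -/
def voronoiCell {α β : Type*} {G : Graph α β} [Fintype E(G)] (ω : G.Orientation) :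
    Set (EuclideanSpace ℝ E(G)) :=
  {x | x ∈ Submodule.span ℝ (toEuclidean '' (ω.flowLattice : Set (E(G) → ℤ))) ∧
    ∀ v ∈ ω.flowLattice, dist x 0 ≤ dist x (toEuclidean v)}

/-- The face of the Voronoi cell supported by the perpendicular bisector of `v`; for a circuit
element `C` this is the codimension one face `F_C`. -/
def bisectorFace {α β : Type*} {G : Graph α β} [Fintype E(G)] (ω : G.Orientation)
    (v : E(G) → ℤ) : Set (EuclideanSpace ℝ E(G)) :=
  {x | x ∈ ω.voronoiCell ∧
    inner ℝ x (toEuclidean v) = inner ℝ (toEuclidean v) (toEuclidean v) / 2}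

/-- The edges of the Voronoi cell: its one-dimensional faces. -/
def IsVoronoiEdge {α β : Type*} {G : Graph α β} [Fintype E(G)] (ω : G.Orientation)
    (ε : Set (EuclideanSpace ℝ E(G))) : Prop :=
  ε.Nonempty ∧ IsExposed ℝ ω.voronoiCell ε ∧ Module.finrank ℝ (vectorSpan ℝ ε) = 1

/-- Parallelism of edges of the Voronoi cell. -/
def parallelSetoid {α β : Type*} {G : Graph α β} [Fintype E(G)] (ω : G.Orientation) :
    Setoid {ε : Set (EuclideanSpace ℝ E(G)) // ω.IsVoronoiEdge ε} where
  r ε ε' := (affineSpan ℝ ε.1).Parallel (affineSpan ℝ ε'.1)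
  iseqv :=
    { refl := fun _ => AffineSubspace.Parallel.refl _
      symm := fun h => h.symm
      trans := fun h h' => h.trans h' }

/-- The parallel classes `[ε]` of edges of the Voronoi cell. -/
def ParallelClass {α β : Type*} {G : Graph α β} [Fintype E(G)] (ω : G.Orientation) : Type _ :=
  Quotient ω.parallelSetoid

/-- `[ε] ∉ F_C`: no edge of the parallel class participates in the face `F_C`. -/
def ParallelClass.Avoids {α β : Type*} {G : Graph α β} [Fintype E(G)] {ω : G.Orientation}
    (c : ω.ParallelClass) (C : E(G) → ℤ) : Prop :=
  ∀ ε : {ε : Set (EuclideanSpace ℝ E(G)) // ω.IsVoronoiEdge ε},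
    Quotient.mk ω.parallelSetoid ε = c → ¬ ε.1 ⊆ ω.bisectorFace C

/-- The set `S_[ε]` of edges of `G`: the complement of the subgraph `H` corresponding to the
parallel class `[ε]`, where `H` is the union of the circuits `C` whose face `F_C` contains an
edge of the class. -/
def ParallelClass.block {α β : Type*} {G : Graph α β} [Fintype E(G)] {ω : G.Orientation}
    (c : ω.ParallelClass) : Set E(G) :=
  {e | ∀ C : E(G) → ℤ, ω.IsCircuitElement C → ¬ c.Avoids C → e ∉ Function.support C}

/-- `m` is a positive integer solution of the linear system attached to the basis `b`: one equation
for each basis circuit, one for each pair of basis circuits. -/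
structure IsPositiveSolution {α β : Type*} {G : Graph α β} [Fintype E(G)] {ω : G.Orientation}
    {r : ℕ} (b : Module.Basis (Fin r) ℤ ω.flowLattice) (m : ω.ParallelClass → ℤ) : Prop where
  pos : ∀ c, 0 < m c
  length : ∀ i, (∑ᶠ (c : ω.ParallelClass) (_ : c.Avoids (b i).1), m c)
    = pairing (b i).1 (b i).1
  intersect : ∀ i j, i ≠ j →
    (∑ᶠ (c : ω.ParallelClass) (_ : c.Avoids (b i).1 ∧ c.Avoids (b j).1), m c)
      = |pairing (b i).1 (b j).1|

end Orientation

end Graph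

namespace Graph

/-! Every real flow is a positive combination of circuits without cancellation in any coordinate
(`conformal_induction`). A circuit element C has coefficients 0, 1, -1, so (C,C) = ∑|C_e|. Hence the
Voronoi inequalities for circuits add up to (x,w) ≤ ½∑|w_e| for all real flows w. The right side is
the support function of the cube [-½,½]^E, so V(G) is the orthogonal projection of that cube, a
zonotope (`voronoiCell_eq_image`).

The face maximizing w is therefore spanned by the projections p(e) of the coordinate vectors with
w_e = 0, and the edges of V(G) are parallel to the p(e). Since (p(e),w) = w_e, the vectors p(e) and
p(f) are proportional exactly when the same flows vanish on e and on f, which means e = f or {e,f}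
is a 2-cut (`sameLine_iff`). The class of e meets F_C exactly when e is not in C. So S consists of
the edges missed by every circuit that misses e, which is the block of e.

By this dictionary the block sizes solve the system. For uniqueness, choose an edge e_c in each
class and let l be the difference of two solutions. Since the basis is cancellation-free, the
products x_e y_e for two basis circuits never have opposite signs, so the equations say that ∑ l_c
x_{e_c} y_{e_c} vanishes on pairs of basis elements, hence identically. On a circuit x² = |x|, so ∑
l_c |x_{e_c}| vanishes on circuits and, by conformality, on all flows. These absolute values have
kinks along different hyperplanes and are linearly independent
(`eq_zero_of_forall_circuit_sum_abs`), so l = 0. -/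

lemma reflTransGen_adj_symm {α β : Type*} {G : Graph α β} {u v : α}
    (h : Relation.ReflTransGen G.Adj u v) : Relation.ReflTransGen G.Adj v u := by
  induction h with
  | refl => exact .refl
  | tail _ hbc ih => exact .head hbc.symm ih

lemma deleteEdges_isLink_iff {α β : Type*} {G : Graph α β} {F : Set β} {e : β} {u v : α} :
    (G.deleteEdges F).IsLink e u v ↔ G.IsLink e u v ∧ e ∉ F := by
  rw [← restrict_edgeSet_sdiff_eq_deleteEdges, restrict_isLink]
  exact ⟨fun h => ⟨h.2, h.1.2⟩, fun h => ⟨⟨h.1.edge_mem, h.2⟩, h.1⟩⟩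

namespace Orientation

variable {α β : Type*} {G : Graph α β} {ω : G.Orientation}

/-! ### Coefficients of circuit elements -/

lemma head_mem (e : E(G)) : ω.head e ∈ V(G) := (ω.isLink e).right_mem

lemma tail_mem (e : E(G)) : ω.tail e ∈ V(G) := (ω.isLink e).left_mem

lemma OrientedCircuit.toFlow_edge (C : ω.OrientedCircuit) (i : Fin (C.n + 1))
    [Decidable (C.forward i)] :
    C.toFlow (C.edge i) = if C.forward i then 1 else -1 := by
  classical
  rw [toFlow, Finset.sum_eq_single i]
  · simp
  · intro j _ hj
    rw [if_neg fun h => hj (C.edge_injective h)]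
  · simp

lemma OrientedCircuit.toFlow_eq_zero (C : ω.OrientedCircuit) {e : E(G)}
    (he : ∀ i, C.edge i ≠ e) : C.toFlow e = 0 := by
  classical
  rw [toFlow]
  exact Finset.sum_eq_zero fun i _ => if_neg (he i)

lemma IsCircuitElement.abs_le_one {x : E(G) → ℤ} (hx : ω.IsCircuitElement x) (e : E(G)) :
    |x e| ≤ 1 := by
  classical
  obtain ⟨C, rfl⟩ := hx
  by_cases h : ∃ i, C.edge i = e
  · obtain ⟨i, rfl⟩ := h
    rw [C.toFlow_edge]
    split_ifs <;> simp
  · push Not at h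
    simp [C.toFlow_eq_zero h]

lemma IsCircuitElement.ne_zero {x : E(G) → ℤ} (hx : ω.IsCircuitElement x) : x ≠ 0 := by
  classical
  obtain ⟨C, rfl⟩ := hx
  intro h
  have h1 := C.toFlow_edge 0
  rw [h] at h1
  split_ifs at h1; simp at h1

variable [Fintype E(G)]

/-! ### Real flows, connectivity and 2-cuts -/

open Classical in
/-- Incoming total minus outgoing total of a real function on the edges at a vertex. -/
noncomputable def excess (ω : G.Orientation) (w : E(G) → ℝ) (v : α) : ℝ :=
  ∑ e : E(G), w e * ((if ω.head e = v then 1 else 0) - (if ω.tail e = v then 1 else 0))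

lemma excess_add (w w' : E(G) → ℝ) (v : α) :
    ω.excess (w + w') v = ω.excess w v + ω.excess w' v := by
  simp only [excess, Pi.add_apply, add_mul, Finset.sum_add_distrib]

lemma excess_smul (a : ℝ) (w : E(G) → ℝ) (v : α) :
    ω.excess (a • w) v = a * ω.excess w v := by
  simp only [excess, Pi.smul_apply, smul_eq_mul, Finset.mul_sum, mul_assoc]

open Classical in
lemma excess_single (e : E(G)) (a : ℝ) (v : α) :
    ω.excess (Pi.single e a) v =
      a * ((if ω.head e = v then 1 else 0) - (if ω.tail e = v then 1 else 0)) := by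
  rw [excess, Finset.sum_eq_single e]
  · simp
  · intro f _ hf
    simp [Pi.single_eq_of_ne hf]
  · simp

/-- The real flows. -/
noncomputable def realFlows (ω : G.Orientation) : Submodule ℝ (E(G) → ℝ) where
  carrier := {w | ∀ v, ω.excess w v = 0}
  zero_mem' := by
    intro v
    simp [excess]
  add_mem' := by
    intro a b ha hb v
    rw [excess_add, ha v, hb v, add_zero]
  smul_mem' := by
    intro k a ha v
    rw [excess_smul, ha v, mul_zero]

lemma cast_mem_realFlows_iff {x : E(G) → ℤ} :
    (fun e => (x e : ℝ)) ∈ ω.realFlows ↔ x ∈ ω.flowLattice := by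
  classical
  have key : ∀ v, ω.excess (fun e => (x e : ℝ)) v =
      (((∑ e : E(G) with ω.head e = v, x e) - (∑ e : E(G) with ω.tail e = v, x e) : ℤ) : ℝ) := by
    intro v
    push_cast
    simp only [excess, Finset.sum_filter, ← Finset.sum_sub_distrib]
    refine Finset.sum_congr rfl fun e _ => ?_
    split_ifs <;> simp
  constructor
  · intro h v _
    have := h v
    rw [key] at this
    convert Int.cast_eq_zero.mp this
  · intro h v
    rw [key]
    by_cases hv : v ∈ V(G)
    · have := h v hv
      rw [Int.cast_eq_zero]
      convert this
    -- Outside `V(G)` no edge ends, so asking for conservation at all of `α` adds nothing.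
    · have h1 : ∀ e : E(G), ω.head e ≠ v := fun e he => hv (he ▸ head_mem e)
      have h2 : ∀ e : E(G), ω.tail e ≠ v := fun e he => hv (he ▸ tail_mem e)
      simp [h1, h2]

/-- Summation by parts: flows are orthogonal to potential differences. -/
lemma sum_mul_sub_eq_zero {w : E(G) → ℝ} (hw : w ∈ ω.realFlows) (h : α → ℝ) :
    ∑ e, w e * (h (ω.head e) - h (ω.tail e)) = 0 := by
  classical
  let T : Finset α := Finset.univ.image ω.head ∪ Finset.univ.image ω.tail
  have h0 : ∑ v ∈ T, h v * ω.excess w v = 0 :=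
    Finset.sum_eq_zero fun v _ => by rw [hw v, mul_zero]
  rw [← h0]
  simp only [excess, Finset.mul_sum]
  rw [Finset.sum_comm]
  refine Finset.sum_congr rfl fun e _ => ?_
  have hh : ω.head e ∈ T := by simp [T]
  have ht : ω.tail e ∈ T := by simp [T]
  have : ∀ v, h v * (w e * ((if ω.head e = v then 1 else 0) - (if ω.tail e = v then 1 else 0)))
      = (if ω.head e = v then w e * h v else 0) - (if ω.tail e = v then w e * h v else 0) := by
    intro v
    split_ifs <;> ring
  simp only [this, Finset.sum_sub_distrib, Finset.sum_ite_eq, hh, ht, if_true]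
  ring

-- Adding the signed edges of a walk transports one unit from its start to its end.
open Classical in
lemma exists_excess_eq_of_reflTransGen (ω : G.Orientation) {F : Set β} {u v : α}
    (h : Relation.ReflTransGen (G.deleteEdges F).Adj u v) :
    ∃ p : E(G) → ℝ, (∀ e : E(G), e.1 ∈ F → p e = 0) ∧
      ∀ z, ω.excess p z = (if v = z then 1 else 0) - (if u = z then 1 else 0) := by
  induction h with
  | refl => exact ⟨0, by simp, by simp [excess]⟩
  | @tail b c _ hbc ih =>
    obtain ⟨p, hp, hz⟩ := ih
    obtain ⟨e, he⟩ := hbc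
    rw [deleteEdges_isLink_iff] at he
    let e' : E(G) := ⟨e, he.1.edge_mem⟩
    have hF : ∀ (a : ℝ) (f : E(G)), f.1 ∈ F → Pi.single (M := fun _ => ℝ) e' a f = 0 := by
      intro a f hf
      refine Pi.single_eq_of_ne ?_ _
      rintro rfl
      exact he.2 hf
    rcases (ω.isLink e').eq_and_eq_or_eq_and_eq he.1 with ⟨h1, h2⟩ | ⟨h1, h2⟩
    · refine ⟨p + Pi.single e' 1, fun f hf => by simp [hp f hf, hF 1 f hf], fun z => ?_⟩
      rw [excess_add, hz, excess_single, h1, h2]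
      ring
    · refine ⟨p + Pi.single e' (-1), fun f hf => by simp [hp f hf, hF (-1) f hf], fun z => ?_⟩
      rw [excess_add, hz, excess_single, h1, h2]
      ring

/-- Close `f` up by a walk from its head to its tail that avoids `F`. -/
lemma exists_realFlow_of_isConnected (ω : G.Orientation) {F : Set β} {f : E(G)} (hf : f.1 ∈ F)
    (h : (G.deleteEdges F).IsConnected) :
    ∃ x ∈ ω.realFlows, x f = 1 ∧ ∀ e : E(G), e.1 ∈ F → e ≠ f → x e = 0 := by
  classical
  obtain ⟨p, hp, hz⟩ := ω.exists_excess_eq_of_reflTransGen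
    (h.2 _ (head_mem (ω := ω) f) _ (tail_mem (ω := ω) f))
  refine ⟨p + Pi.single f 1, fun z => ?_, by simp [hp f hf], fun e he hef => ?_⟩
  · rw [excess_add, hz, excess_single]
    ring
  · simp [hp e he, hef]

/-- If the ends of `f` were separated, `f` would be the only edge carrying flow across a cut,
forcing `x f = 0`. So `f` can be bypassed in every walk that avoids `e`. -/
lemma isConnected_of_realFlow {e f : E(G)} (h : (G.deleteEdges {e.1}).IsConnected)
    {x : E(G) → ℝ} (hx : x ∈ ω.realFlows) (hxe : x e = 0) (hxf : x f ≠ 0) :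
    (G.deleteEdges {e.1, f.1}).IsConnected := by
  classical
  set R := Relation.ReflTransGen (G.deleteEdges {e.1, f.1}).Adj with hR
  have hstep : ∀ g : E(G), g ≠ e → g ≠ f → R (ω.tail g) (ω.head g) := by
    intro g hge hgf
    refine .single ⟨g.1, ?_⟩
    rw [deleteEdges_isLink_iff]
    refine ⟨ω.isLink g, ?_⟩
    simp only [Set.mem_insert_iff, Set.mem_singleton_iff, not_or]
    exact ⟨fun h => hge (Subtype.ext h), fun h => hgf (Subtype.ext h)⟩
  have hf : R (ω.tail f) (ω.head f) := by
    by_contra hcon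
    -- The potential is the indicator of the component of the tail of `f`.
    have h0 := sum_mul_sub_eq_zero hx (fun z => if R (ω.tail f) z then 1 else 0)
    rw [Finset.sum_eq_single f] at h0
    · simp only [hcon, if_false, show R (ω.tail f) (ω.tail f) from .refl, if_true] at h0
      apply hxf
      linarith
    · intro g _ hgf
      by_cases hge : g = e
      · rw [hge, hxe, zero_mul]
      · have h1 := hstep g hge hgf
        have : R (ω.tail f) (ω.head g) ↔ R (ω.tail f) (ω.tail g) :=
          ⟨fun h => h.trans (reflTransGen_adj_symm h1), fun h => h.trans h1⟩
        simp [this]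
    · simp
  refine ⟨h.1, fun u hu v hv => ?_⟩
  refine Relation.ReflTransGen.lift' (p := (G.deleteEdges {e.1, f.1}).Adj) id ?_ _ _ (h.2 u hu v hv)
  rintro a c ⟨g, hg⟩
  rw [deleteEdges_isLink_iff] at hg
  let g' : E(G) := ⟨g, hg.1.edge_mem⟩
  have hge : g' ≠ e := fun hh => hg.2 (by simp [← hh, g'])
  have hlink : R (ω.tail g') (ω.head g') := by
    by_cases hgf : g' = f
    · rw [hgf]; exact hf
    · exact hstep g' hge hgf
  rcases (ω.isLink g').eq_and_eq_or_eq_and_eq hg.1 with ⟨h1, h2⟩ | ⟨h1, h2⟩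
  · rw [h1, h2] at hlink; exact hlink
  · rw [h1, h2] at hlink; exact reflTransGen_adj_symm hlink

lemma exists_realFlow_eq_one (hG : G.IsTwoEdgeConnected) (ω : G.Orientation) (f : E(G)) :
    ∃ x ∈ ω.realFlows, x f = 1 := by
  obtain ⟨x, hx, hxf, -⟩ := ω.exists_realFlow_of_isConnected (F := {f.1}) (f := f) rfl
    (hG.2 _ f.2)
  exact ⟨x, hx, hxf⟩

/-- Two edges on which the same real flows vanish. -/
def SameLine (ω : G.Orientation) (e f : E(G)) : Prop :=
  ∀ x ∈ ω.realFlows, x e = 0 ↔ x f = 0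

/-- Nonzero linear functionals with nested kernels are proportional; coordinates are nonzero on
flows because there are no bridges. -/
lemma exists_ratio (hG : G.IsTwoEdgeConnected) {e f : E(G)}
    (h : ∀ x ∈ ω.realFlows, x e = 0 → x f = 0) :
    ∃ c : ℝ, c ≠ 0 ∧ ∀ x ∈ ω.realFlows, x f = c * x e := by
  obtain ⟨y, hy, hye⟩ := exists_realFlow_eq_one hG ω e
  have key : ∀ x ∈ ω.realFlows, x f = y f * x e := by
    intro x hx
    have := h (x - x e • y) (sub_mem hx (Submodule.smul_mem _ _ hy)) (by simp [hye])
    simp only [Pi.sub_apply, Pi.smul_apply, smul_eq_mul] at this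
    linarith
  refine ⟨y f, fun h0 => ?_, key⟩
  obtain ⟨z, hz, hzf⟩ := exists_realFlow_eq_one hG ω f
  have := key z hz
  rw [h0, hzf] at this
  simp at this

lemma sameLine_of_forall (hG : G.IsTwoEdgeConnected) {e f : E(G)}
    (h : ∀ x ∈ ω.realFlows, x e = 0 → x f = 0) : ω.SameLine e f := by
  obtain ⟨c, hc, hx⟩ := exists_ratio hG h
  intro x hxR
  rw [hx x hxR]
  simp [hc]

lemma sameLine_iff (hG : G.IsTwoEdgeConnected) {e f : E(G)} :
    ω.SameLine e f ↔ e = f ∨ G.IsTwoCut e f := by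
  constructor
  · intro h
    by_contra! hcon
    obtain ⟨hne, hcut⟩ := hcon
    have hconn : (G.deleteEdges {e.1, f.1}).IsConnected := by
      by_contra hc
      exact hcut ⟨hne, hc⟩
    obtain ⟨x, hx, hxf, hxe⟩ := ω.exists_realFlow_of_isConnected (f := f) (by simp) hconn
    have := (h x hx).mp (hxe e (by simp) hne)
    rw [hxf] at this
    exact one_ne_zero this
  · rintro (rfl | ⟨hne, hcut⟩)
    · exact fun x _ => Iff.rfl
    · refine sameLine_of_forall hG fun x hx hxe => ?_
      by_contra hxf
      exact hcut (isConnected_of_realFlow (hG.2 _ e.2) hx hxe hxf)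

/-! ### Circuits and conformal decomposition -/

lemma IsCircuitElement.mem_flowLattice {x : E(G) → ℤ} (hx : ω.IsCircuitElement x) :
    x ∈ ω.flowLattice := by
  classical
  obtain ⟨C, rfl⟩ := hx
  rw [← cast_mem_realFlows_iff]
  intro v
  have h1 : ω.excess (fun e => (C.toFlow e : ℝ)) v =
      ∑ i, ((if C.vert (i + 1) = v then 1 else 0) - (if C.vert i = v then 1 else 0) : ℝ) := by
    simp only [excess, OrientedCircuit.toFlow, Int.cast_sum, Finset.sum_mul]
    rw [Finset.sum_comm]
    refine Finset.sum_congr rfl fun i _ => ?_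
    rw [Finset.sum_eq_single (C.edge i)]
    · by_cases hi : C.forward i
      · obtain ⟨ht, hh⟩ := C.step_forward i hi
        simp [hi, ht, hh]
      · obtain ⟨hh, ht⟩ := C.step_backward i hi
        simp [hi, ht, hh]
    · intro e _ he
      rw [if_neg fun h => he h.symm]
      simp
    · simp
  rw [h1, Finset.sum_sub_distrib, sub_eq_zero]
  exact Equiv.sum_comp (Equiv.addRight (1 : Fin (C.n + 1)))
    (fun i => if C.vert i = v then (1 : ℝ) else 0)

/-- The support of a nonzero real flow contains a circuit traversed in the direction of the flow. -/
lemma exists_conformal_circuit {w : E(G) → ℝ} (hw : w ∈ ω.realFlows) (h0 : w ≠ 0) :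
    ∃ x : E(G) → ℤ, ω.IsCircuitElement x ∧ ∀ e, x e ≠ 0 → 0 < x e * w e := by
  classical
  -- Each edge of the support is redirected along the flow, from `s` to `t`; conservation then lets
  -- every such edge be continued.
  let s : E(G) → α := fun e => if 0 < w e then ω.tail e else ω.head e
  let t : E(G) → α := fun e => if 0 < w e then ω.head e else ω.tail e
  have hbal : ∀ v, ∑ e, (if t e = v then |w e| else 0) = ∑ e, (if s e = v then |w e| else 0) := by
    intro v
    rw [← sub_eq_zero, ← Finset.sum_sub_distrib]
    refine Eq.trans (Finset.sum_congr rfl fun e _ => ?_) (hw v)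
    by_cases h : 0 < w e
    · simp only [s, t, h, if_true, abs_of_pos h]
      split_ifs <;> ring
    · simp only [s, t, h, if_false, abs_of_nonpos (not_lt.mp h)]
      split_ifs <;> ring
  have hnext : ∀ e : {e // w e ≠ 0}, ∃ f : {e // w e ≠ 0}, s f.1 = t e.1 := by
    rintro ⟨e, he⟩
    have h1 : 0 < ∑ f, (if t f = t e then |w f| else 0) := by
      refine Finset.sum_pos' (fun f _ => by split_ifs <;> positivity) ⟨e, Finset.mem_univ _, ?_⟩
      simpa using he
    rw [hbal] at h1
    obtain ⟨f, -, hf⟩ := Finset.exists_ne_zero_of_sum_ne_zero h1.ne'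
    by_cases hs : s f = t e
    · refine ⟨⟨f, ?_⟩, hs⟩
      simpa [hs] using hf
    · simp [hs] at hf
  choose next hnext using hnext
  obtain ⟨e0, he0⟩ : ∃ e, w e ≠ 0 := by
    by_contra! h
    exact h0 (funext h)
  let a : ℕ → {e // w e ≠ 0} := fun k => next^[k] ⟨e0, he0⟩
  have ha : ∀ k, s (a (k + 1)).1 = t (a k).1 := by
    intro k
    simp only [a, Function.iterate_succ_apply']
    exact hnext _
  -- A return after `d + 1` steps; minimal `d` over all starting points makes the vertices in
  -- between distinct.
  have hrep : ∃ d i, s (a (i + d + 1)).1 = s (a i).1 := by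
    obtain ⟨i, j, hij, h⟩ := Finite.exists_ne_map_eq_of_infinite a
    rcases lt_or_gt_of_ne hij with h1 | h1
    · obtain ⟨d, rfl⟩ := Nat.exists_eq_add_of_lt h1
      exact ⟨d, i, by rw [h]⟩
    · obtain ⟨d, rfl⟩ := Nat.exists_eq_add_of_lt h1
      exact ⟨d, j, by rw [h]⟩
  obtain ⟨i, hi⟩ := Nat.find_spec hrep
  have hmin : ∀ m < Nat.find hrep, ∀ j, s (a (j + m + 1)).1 ≠ s (a j).1 := by
    intro m hm j hj
    exact Nat.find_min hrep hm ⟨j, hj⟩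
  generalize Nat.find hrep = d at hi hmin
  have hinj : Function.Injective fun k : Fin (d + 1) => s (a (i + k)).1 := by
    have : ∀ k l : Fin (d + 1), k < l → s (a (i + k)).1 ≠ s (a (i + l)).1 := by
      intro k l hkl h
      obtain ⟨m, hm⟩ := Nat.exists_eq_add_of_lt (Fin.lt_def.mp hkl)
      refine hmin m (by have := l.2; omega) (i + k) ?_
      rw [h, show i + l = i + k + m + 1 by omega]
    intro k l h
    by_contra hne
    rcases lt_or_gt_of_ne hne with h1 | h1
    · exact this _ _ h1 h
    · exact this _ _ h1 h.symm
  have hsucc : ∀ k : Fin (d + 1), s (a (i + (k + 1 : Fin (d + 1)))).1 = t (a (i + k)).1 := by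
    intro k
    rw [← ha]
    by_cases hk : k = Fin.last d
    · subst hk
      simp only [Fin.last_add_one, Fin.val_zero, Fin.val_last, add_zero]
      exact hi.symm
    · rw [Fin.val_add_one, if_neg hk, add_assoc]
  let C : ω.OrientedCircuit :=
    { n := d
      vert := fun k => s (a (i + k)).1
      edge := fun k => (a (i + k)).1
      forward := fun k => 0 < w (a (i + k)).1
      vert_injective := hinj
      edge_injective := fun k l h => hinj (congrArg s h)
      step_forward := fun k hk => by
        rw [hsucc]
        simp [s, t, hk]
      step_backward := fun k hk => by
        rw [hsucc]
        simp [s, t, hk] }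
  refine ⟨C.toFlow, ⟨C, rfl⟩, fun e he => ?_⟩
  obtain ⟨k, rfl⟩ : ∃ k, C.edge k = e := by
    by_contra! h
    exact he (C.toFlow_eq_zero h)
  rw [C.toFlow_edge]
  by_cases hk : C.forward k
  · rw [if_pos hk]
    simpa using hk
  · rw [if_neg hk]
    have h1 : w (C.edge k) ≠ 0 := (a (i + k)).2
    have h2 : ¬ 0 < w (C.edge k) := hk
    have h3 : w (C.edge k) < 0 := lt_of_le_of_ne (not_lt.mp h2) h1
    simpa using h3

/-- Every real flow is a conformal sum of positive multiples of circuits. -/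
theorem conformal_induction {P : (E(G) → ℝ) → Prop} (zero : P 0)
    (add : ∀ (w : E(G) → ℝ) (x : E(G) → ℤ) (a : ℝ), w ∈ ω.realFlows → ω.IsCircuitElement x →
      0 < a → (∀ e, |w e + a * x e| = |w e| + a * |(x e : ℝ)|) → P w →
      P (fun e => w e + a * x e))
    {w : E(G) → ℝ} (hw : w ∈ ω.realFlows) : P w := by
  classical
  induction hn : (Finset.univ.filter fun e => w e ≠ 0).card using Nat.strong_induction_on
    generalizing w with
  | _ n ih =>
    by_cases h0 : w = 0
    · rw [h0]; exact zero
    obtain ⟨x, hx, hxw⟩ := exists_conformal_circuit hw h0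
    have hne : (Finset.univ.filter fun e => x e ≠ 0).Nonempty := by
      by_contra hemp
      rw [Finset.not_nonempty_iff_eq_empty, Finset.filter_eq_empty_iff] at hemp
      exact hx.ne_zero (funext fun e => by simpa using hemp (Finset.mem_univ e))
    obtain ⟨e0, he0, hmin⟩ := Finset.exists_min_image _ (fun e => |w e|) hne
    simp only [Finset.mem_filter, Finset.mem_univ, true_and] at he0 hmin
    have hx1 : ∀ e, x e ≠ 0 → (x e = 1 ∧ 0 < w e) ∨ (x e = -1 ∧ w e < 0) := by
      intro e he
      have h1 := hxw e he
      have h2 := abs_le.mp (hx.abs_le_one e)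
      have h3 : x e = 1 ∨ x e = -1 := by omega
      rcases h3 with h3 | h3
      · left; refine ⟨h3, ?_⟩; rw [h3] at h1; simpa using h1
      · right; refine ⟨h3, ?_⟩; rw [h3] at h1; simpa using h1
    -- The least flow on the circuit: subtracting `a * x` kills `e0` and reverses no sign.
    set a := |w e0| with ha
    have hapos : 0 < a := by
      rcases hx1 e0 he0 with ⟨-, h⟩ | ⟨-, h⟩
      · exact abs_pos.mpr h.ne'
      · exact abs_pos.mpr h.ne
    set w' : E(G) → ℝ := fun e => w e - a * x e with hw'
    have hxR := cast_mem_realFlows_iff.mpr hx.mem_flowLattice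
    have hw'R : w' ∈ ω.realFlows := by
      have : w' = w - a • (fun e => (x e : ℝ)) := by
        ext e; simp [hw']
      rw [this]
      exact sub_mem hw (Submodule.smul_mem _ _ hxR)
    have hww : w = fun e => w' e + a * x e := by
      ext e; simp [hw']
    have hcard : (Finset.univ.filter fun e => w' e ≠ 0).card < n := by
      rw [← hn]
      apply Finset.card_lt_card
      rw [Finset.ssubset_iff_of_subset]
      · refine ⟨e0, ?_, ?_⟩
        · simpa [ha] using hapos
        · simp only [Finset.mem_filter, Finset.mem_univ, true_and, not_not, hw', ha]
          rcases hx1 e0 he0 with ⟨h, h'⟩ | ⟨h, h'⟩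
          · rw [h, abs_of_pos h']; simp
          · rw [h, abs_of_neg h']; simp
      · intro e
        simp only [Finset.mem_filter, Finset.mem_univ, true_and, hw']
        intro he hwe
        apply he
        have : x e = 0 := by
          by_contra hxe
          have := hxw e hxe
          simp [hwe] at this
        simp [hwe, this]
    have hP := ih _ hcard hw'R rfl
    rw [hww]
    refine add w' x a hw'R hx hapos (fun e => ?_) hP
    by_cases hxe : x e = 0
    · simp [hxe]
    · have hm := hmin e hxe
      rcases hx1 e hxe with ⟨h, h'⟩ | ⟨h, h'⟩
      · rw [abs_of_pos h'] at hm
        simp only [hw', h]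
        have : 0 ≤ w e - a := by linarith
        push_cast
        rw [mul_one, abs_of_nonneg this, sub_add_cancel, abs_of_pos h']
        simp
      · rw [abs_of_neg h'] at hm
        simp only [hw', h]
        have : w e + a ≤ 0 := by linarith
        push_cast
        rw [show w e - a * -1 = w e + a by ring, abs_of_nonpos this,
          show w e + a + a * -1 = w e by ring, abs_of_neg h']
        simp

/-! ### The Voronoi cell as the projection of a cube -/

/-- The real span of the lattice of integer flows in Euclidean space. -/
def flowSpace (ω : G.Orientation) : Submodule ℝ (EuclideanSpace ℝ E(G)) :=
  Submodule.span ℝ (toEuclidean '' (ω.flowLattice : Set (E(G) → ℤ)))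

lemma toEuclidean_mem_flowSpace {x : E(G) → ℤ} (hx : x ∈ ω.flowLattice) :
    toEuclidean x ∈ ω.flowSpace :=
  Submodule.subset_span ⟨x, hx, rfl⟩

lemma mem_flowSpace {x : EuclideanSpace ℝ E(G)} : x ∈ ω.flowSpace ↔ x.ofLp ∈ ω.realFlows := by
  constructor
  · intro hx
    have : ω.flowSpace ≤ ω.realFlows.comap (WithLp.linearEquiv 2 ℝ (E(G) → ℝ)).toLinearMap := by
      refine Submodule.span_le.mpr ?_
      rintro _ ⟨y, hy, rfl⟩
      exact cast_mem_realFlows_iff.mpr hy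
    exact this hx
  · intro hx
    have := conformal_induction (ω := ω) (P := fun w => WithLp.toLp 2 w ∈ ω.flowSpace)
      (zero_mem _) (fun w y a _ hy _ _ hP =>
        add_mem hP (Submodule.smul_mem _ a (toEuclidean_mem_flowSpace hy.mem_flowLattice))) hx
    exact this

omit [Fintype E(G)] in
lemma toEuclidean_apply (x : E(G) → ℤ) (e : E(G)) : toEuclidean x e = (x e : ℝ) := rfl

lemma inner_eq_sum (x y : EuclideanSpace ℝ E(G)) : inner ℝ x y = ∑ e, x e * y e := by
  simp [PiLp.inner_apply, mul_comm]

/-- Orthogonal projection to the real span of the flow lattice. -/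
noncomputable def flowProj (ω : G.Orientation) :
    EuclideanSpace ℝ E(G) →L[ℝ] EuclideanSpace ℝ E(G) :=
  ω.flowSpace.starProjection

lemma flowProj_mem (y : EuclideanSpace ℝ E(G)) : ω.flowProj y ∈ ω.flowSpace :=
  Submodule.starProjection_apply_mem _ _

lemma inner_flowProj {w : EuclideanSpace ℝ E(G)} (hw : w ∈ ω.flowSpace)
    (y : EuclideanSpace ℝ E(G)) : inner ℝ (ω.flowProj y) w = inner ℝ y w := by
  rw [flowProj, Submodule.inner_starProjection_left_eq_right,
    Submodule.starProjection_eq_self_iff.mpr hw]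

/-- The circuit inequalities add up along a conformal decomposition. Conversely, |v_e| ≤ v_e² for
integers. -/
lemma mem_voronoiCell_iff {x : EuclideanSpace ℝ E(G)} :
    x ∈ ω.voronoiCell ↔
      x ∈ ω.flowSpace ∧ ∀ w ∈ ω.flowSpace, inner ℝ x w ≤ (∑ e, |w e|) / 2 := by
  have hdist : ∀ v : EuclideanSpace ℝ E(G), dist x 0 ≤ dist x v ↔ 2 * inner ℝ x v ≤ inner ℝ v v := by
    intro v
    rw [dist_zero_right, dist_eq_norm, ← sq_le_sq₀ (norm_nonneg _) (norm_nonneg _),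
      norm_sub_sq_real, real_inner_self_eq_norm_sq]
    constructor <;> intro h <;> linarith
  refine and_congr_right fun hx => ⟨fun h w hw => ?_, fun h v hv => ?_⟩
  · have := conformal_induction (ω := ω)
      (P := fun w => inner ℝ x (WithLp.toLp 2 w) ≤ (∑ e, |w e|) / 2)
      (by simp) (fun w y a _ hy ha habs hP => ?_) (mem_flowSpace.mp hw)
    · exact this
    · have h1 := (hdist _).mp (h y hy.mem_flowLattice)
      have h2 : inner ℝ (toEuclidean y) (toEuclidean y) = ∑ e, |(y e : ℝ)| := by
        rw [inner_eq_sum]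
        refine Finset.sum_congr rfl fun e _ => ?_
        have h3 := abs_le.mp (hy.abs_le_one e)
        have h4 : y e = 0 ∨ y e = 1 ∨ y e = -1 := by omega
        rcases h4 with h4 | h4 | h4 <;> simp [toEuclidean_apply, h4]
      have h5 : (WithLp.toLp 2 fun e => w e + a * (y e : ℝ)) =
          WithLp.toLp 2 w + a • toEuclidean y := rfl
      rw [h5, inner_add_right, inner_smul_right]
      simp only [habs, Finset.sum_add_distrib, ← Finset.mul_sum]
      rw [← h2]
      nlinarith
  · rw [hdist]
    have h1 := h _ (toEuclidean_mem_flowSpace hv)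
    have h2 : ∑ e, |toEuclidean v e| ≤ inner ℝ (toEuclidean v) (toEuclidean v) := by
      rw [inner_eq_sum]
      refine Finset.sum_le_sum fun e _ => ?_
      rw [toEuclidean_apply, ← abs_mul_abs_self]
      by_cases h0 : v e = 0
      · simp [h0]
      · have : (1 : ℝ) ≤ |(v e : ℝ)| := by exact_mod_cast Int.one_le_abs h0
        nlinarith
    linarith

lemma voronoiCell_subset_flowSpace : ω.voronoiCell ⊆ ω.flowSpace := fun _ hx => hx.1

/-- The cube with side 1 centred at the origin. -/
def cube (G : Graph α β) : Set (EuclideanSpace ℝ E(G)) := {y | ∀ e, |y e| ≤ 1 / 2}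

omit [Fintype E(G)] in
lemma convex_cube : Convex ℝ (cube G) := by
  intro x hx y hy a b ha hb hab e
  have h1 := abs_le.mp (hx e)
  have h2 := abs_le.mp (hy e)
  simp only [PiLp.add_apply, PiLp.smul_apply, smul_eq_mul]
  rw [abs_le]
  constructor <;> nlinarith

omit [Fintype E(G)] in
lemma isCompact_cube : IsCompact (cube G) := by
  have h : cube G =
      WithLp.toLp 2 '' (Set.univ.pi fun _ : E(G) => Set.Icc (-(1 / 2) : ℝ) (1 / 2)) := by
    ext y
    simp only [cube, Set.mem_ofPred_eq, abs_le]
    constructor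
    · intro hy
      exact ⟨y.ofLp, fun e _ => hy e, rfl⟩
    · rintro ⟨z, hz, rfl⟩ e
      exact hz e trivial
  rw [h]
  exact (isCompact_univ_pi fun _ => isCompact_Icc).image (PiLp.continuous_toLp 2 _)

/-- The vertex of the cube (or the centre of its face) at which `w` is maximal. -/
noncomputable def halfSign (w : EuclideanSpace ℝ E(G)) : EuclideanSpace ℝ E(G) :=
  WithLp.toLp 2 fun e => if w e = 0 then 0 else |w e| / w e / 2

omit [Fintype E(G)] in
lemma halfSign_mem_cube (w : EuclideanSpace ℝ E(G)) : halfSign w ∈ cube G := by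
  intro e
  simp only [halfSign]
  split_ifs with h
  · simp
  · rw [abs_div, abs_div, abs_abs, div_self (abs_ne_zero.mpr h)]
    norm_num

omit [Fintype E(G)] in
lemma halfSign_mul (w : EuclideanSpace ℝ E(G)) (e : E(G)) : halfSign w e * w e = |w e| / 2 := by
  simp only [halfSign]
  split_ifs with h
  · simp [h]
  · field_simp

omit [Fintype E(G)] in
lemma mul_le_of_mem_cube {y : EuclideanSpace ℝ E(G)} (hy : y ∈ cube G)
    (w : EuclideanSpace ℝ E(G)) (e : E(G)) : y e * w e ≤ |w e| / 2 := by
  have h1 := hy e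
  calc y e * w e ≤ |y e * w e| := le_abs_self _
    _ = |y e| * |w e| := abs_mul _ _
    _ ≤ 1 / 2 * |w e| := by gcongr
    _ = |w e| / 2 := by ring

/-- The Voronoi cell is the projection of a cube. -/
theorem voronoiCell_eq_image : ω.voronoiCell = ω.flowProj '' cube G := by
  apply Set.Subset.antisymm
  · intro x hx
    rw [mem_voronoiCell_iff] at hx
    by_contra hcon
    -- A separating functional, with normal projected to the flow space, would exceed the support
    -- function of the cube, which is attained at `halfSign w`.
    obtain ⟨l, u, hl, hu⟩ := geometric_hahn_banach_closed_point
      (convex_cube.linear_image ω.flowProj.toLinearMap)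
      (isCompact_cube.image ω.flowProj.continuous).isClosed hcon
    set z := (InnerProductSpace.toDual ℝ (EuclideanSpace ℝ E(G))).symm l with hz
    have hlz : ∀ y, l y = inner ℝ z y := fun y => by
      rw [hz, InnerProductSpace.toDual_symm_apply]
    set w := ω.flowProj z with hw
    have hlw : ∀ y ∈ ω.flowSpace, l y = inner ℝ y w := by
      intro y hy
      rw [hlz, real_inner_comm w y, hw, inner_flowProj hy]
    have h1 : l (ω.flowProj (halfSign w)) < u := hl _ ⟨_, halfSign_mem_cube w, rfl⟩
    rw [hlw _ (flowProj_mem _)] at h1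
    have h2 := hx.2 w (flowProj_mem _)
    rw [hlw _ hx.1] at hu
    have h3 : inner ℝ (ω.flowProj (halfSign w)) w = (∑ e, |w e|) / 2 := by
      rw [inner_flowProj (flowProj_mem _), inner_eq_sum, Finset.sum_div]
      exact Finset.sum_congr rfl fun e _ => halfSign_mul w e
    linarith
  · rintro _ ⟨y, hy, rfl⟩
    rw [mem_voronoiCell_iff]
    refine ⟨flowProj_mem y, fun w hw => ?_⟩
    rw [inner_flowProj hw, inner_eq_sum, Finset.sum_div]
    exact Finset.sum_le_sum fun e _ => mul_le_of_mem_cube hy w e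

/-! ### Faces and edge directions of the cell -/

/-- The face of the Voronoi cell on which the linear form given by `w` is maximal. -/
def cellFace (ω : G.Orientation) (w : EuclideanSpace ℝ E(G)) : Set (EuclideanSpace ℝ E(G)) :=
  {x | x ∈ ω.voronoiCell ∧ inner ℝ x w = (∑ e, |w e|) / 2}

/-- Equality in a sum of coordinatewise bounds forces equality in each, so the face is the image of
a face of the cube. -/
lemma mem_cellFace_iff {w : EuclideanSpace ℝ E(G)} (hw : w ∈ ω.flowSpace)
    {x : EuclideanSpace ℝ E(G)} :
    x ∈ ω.cellFace w ↔ ∃ y ∈ cube G, (∀ e, y e * w e = |w e| / 2) ∧ ω.flowProj y = x := by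
  constructor
  · rintro ⟨hx, hxw⟩
    rw [voronoiCell_eq_image] at hx
    obtain ⟨y, hy, rfl⟩ := hx
    refine ⟨y, hy, ?_, rfl⟩
    rw [inner_flowProj hw, inner_eq_sum, Finset.sum_div,
      Finset.sum_eq_sum_iff_of_le fun e _ => mul_le_of_mem_cube hy w e] at hxw
    exact fun e => hxw e (Finset.mem_univ e)
  · rintro ⟨y, hy, hyw, rfl⟩
    refine ⟨?_, ?_⟩
    · rw [voronoiCell_eq_image]
      exact ⟨y, hy, rfl⟩
    · rw [inner_flowProj hw, inner_eq_sum, Finset.sum_div]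
      exact Finset.sum_congr rfl fun e _ => hyw e

lemma cellFace_nonempty {w : EuclideanSpace ℝ E(G)} (hw : w ∈ ω.flowSpace) :
    (ω.cellFace w).Nonempty :=
  ⟨_, (mem_cellFace_iff hw).mpr ⟨_, halfSign_mem_cube w, halfSign_mul w, rfl⟩⟩

lemma cellFace_eq_setOf_forall_le {w : EuclideanSpace ℝ E(G)} (hw : w ∈ ω.flowSpace) :
    ω.cellFace w = {x | x ∈ ω.voronoiCell ∧ ∀ y ∈ ω.voronoiCell, inner ℝ y w ≤ inner ℝ x w} := by
  ext x
  refine and_congr_right fun hx => ⟨fun h y hy => ?_, fun h => ?_⟩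
  · rw [h]
    exact (mem_voronoiCell_iff.mp hy).2 w hw
  · obtain ⟨y, hy, hyw⟩ := cellFace_nonempty hw
    refine le_antisymm ((mem_voronoiCell_iff.mp hx).2 w hw) ?_
    rw [← hyw]
    exact h y hy

lemma isExposed_cellFace {w : EuclideanSpace ℝ E(G)} (hw : w ∈ ω.flowSpace) :
    IsExposed ℝ ω.voronoiCell (ω.cellFace w) := by
  intro _
  refine ⟨innerSL ℝ w, ?_⟩
  rw [cellFace_eq_setOf_forall_le hw]
  simp only [innerSL_apply_apply, real_inner_comm w]

/-- Projecting the normal to the flow space does not change the functional on the cell. -/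
lemma exists_eq_cellFace {ε : Set (EuclideanSpace ℝ E(G))} (hne : ε.Nonempty)
    (hε : IsExposed ℝ ω.voronoiCell ε) : ∃ w ∈ ω.flowSpace, ε = ω.cellFace w := by
  obtain ⟨l, rfl⟩ := hε hne
  set z := (InnerProductSpace.toDual ℝ (EuclideanSpace ℝ E(G))).symm l with hz
  have hlw : ∀ y ∈ ω.voronoiCell, l y = inner ℝ y (ω.flowProj z) := by
    intro y hy
    rw [real_inner_comm, inner_flowProj (voronoiCell_subset_flowSpace hy), hz,
      InnerProductSpace.toDual_symm_apply]
  refine ⟨ω.flowProj z, flowProj_mem _, ?_⟩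
  rw [cellFace_eq_setOf_forall_le (flowProj_mem _)]
  ext x
  refine and_congr_right fun hx => forall₂_congr fun y hy => ?_
  rw [hlw x hx, hlw y hy]

open Classical in
/-- The projection of a coordinate vector: the direction of an edge of the Voronoi cell. -/
noncomputable def edgeDir (ω : G.Orientation) (e : E(G)) : EuclideanSpace ℝ E(G) :=
  ω.flowProj (EuclideanSpace.single e 1)

lemma inner_edgeDir {w : EuclideanSpace ℝ E(G)} (hw : w ∈ ω.flowSpace) (e : E(G)) :
    inner ℝ (ω.edgeDir e) w = w e := by
  classical
  rw [edgeDir, inner_flowProj hw, EuclideanSpace.inner_single_left]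
  simp

/-- On the corresponding cube face the coordinates with `w e ≠ 0` are fixed and the others are free.
-/
lemma vectorSpan_cellFace {w : EuclideanSpace ℝ E(G)} (hw : w ∈ ω.flowSpace) :
    vectorSpan ℝ (ω.cellFace w) = Submodule.span ℝ (ω.edgeDir '' {e | w e = 0}) := by
  classical
  apply le_antisymm
  · rw [vectorSpan_def, Submodule.span_le]
    rintro _ ⟨x, hx, x', hx', rfl⟩
    obtain ⟨y, hy, hyw, rfl⟩ := (mem_cellFace_iff hw).mp hx
    obtain ⟨y', hy', hyw', rfl⟩ := (mem_cellFace_iff hw).mp hx'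
    have hsum : y - y' = ∑ e, (y e - y' e) • EuclideanSpace.single e (1 : ℝ) := by
      ext f
      simp [Finset.sum_apply, Pi.single_apply]
    change ω.flowProj y - ω.flowProj y' ∈ _
    rw [← map_sub, hsum, map_sum]
    refine Submodule.sum_mem _ fun e _ => ?_
    rw [map_smul]
    by_cases he : w e = 0
    · exact Submodule.smul_mem _ _ (Submodule.subset_span ⟨e, he, rfl⟩)
    · have : y e = y' e := mul_right_cancel₀ he ((hyw e).trans (hyw' e).symm)
      rw [this, sub_self, zero_smul]
      exact zero_mem _
  · rw [Submodule.span_le]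
    rintro _ ⟨e, he, rfl⟩
    have he : w e = 0 := he
    have h0 : ω.flowProj (halfSign w) ∈ ω.cellFace w :=
      (mem_cellFace_iff hw).mpr ⟨_, halfSign_mem_cube w, halfSign_mul w, rfl⟩
    -- `halfSign` is 0 at `e`, which leaves room for a move by 1/2 inside the cube.
    have h1 : ω.flowProj (halfSign w + EuclideanSpace.single e (1 / 2 : ℝ)) ∈ ω.cellFace w := by
      refine (mem_cellFace_iff hw).mpr ⟨_, fun f => ?_, fun f => ?_, rfl⟩
      · by_cases hf : f = e
        · subst hf
          simp [halfSign, he]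
        · simpa [hf] using halfSign_mem_cube w f
      · by_cases hf : f = e
        · subst hf
          simp [he]
        · simpa [hf] using halfSign_mul w f
    have h2 := Submodule.smul_mem _ (2 : ℝ) (vsub_mem_vectorSpan ℝ h1 h0)
    rw [vsub_eq_sub, map_add, add_sub_cancel_left, ← map_smul] at h2
    have h3 : (2 : ℝ) • EuclideanSpace.single e (1 / 2 : ℝ) = EuclideanSpace.single e (1 : ℝ) := by
      ext f
      by_cases hf : f = e
      · subst hf; simp
      · simp [hf]
    rw [h3] at h2
    exact h2

lemma edgeDir_ne_zero (hG : G.IsTwoEdgeConnected) (e : E(G)) : ω.edgeDir e ≠ 0 := by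
  intro h
  obtain ⟨x, hx, hxe⟩ := exists_realFlow_eq_one hG ω e
  have h1 := inner_edgeDir (ω := ω) (w := WithLp.toLp 2 x) (mem_flowSpace.mpr hx) e
  rw [h, inner_zero_left] at h1
  exact one_ne_zero (hxe.symm.trans h1.symm)

/-- `edgeDir e` represents the `e`-th coordinate on flows, so proportionality means equal kernels.
-/
lemma span_edgeDir_eq_iff (hG : G.IsTwoEdgeConnected) {e f : E(G)} :
    Submodule.span ℝ {ω.edgeDir e} = Submodule.span ℝ {ω.edgeDir f} ↔ ω.SameLine e f := by
  constructor
  · intro h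
    have hf : ω.edgeDir f ∈ Submodule.span ℝ {ω.edgeDir e} := by
      rw [h]; exact Submodule.mem_span_singleton_self _
    obtain ⟨c, hc⟩ := Submodule.mem_span_singleton.mp hf
    refine sameLine_of_forall hG fun x hx hxe => ?_
    have hx' : WithLp.toLp 2 x ∈ ω.flowSpace := mem_flowSpace.mpr hx
    have h1 := inner_edgeDir hx' f
    rw [← hc, real_inner_smul_left, inner_edgeDir hx'] at h1
    have h2 : c * x e = x f := h1
    rw [← h2, hxe, mul_zero]
  · intro h
    obtain ⟨c, hc, hx⟩ := exists_ratio hG fun x hx => (h x hx).mp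
    have h0 : ω.edgeDir f - c • ω.edgeDir e = 0 := by
      have hmem : ω.edgeDir f - c • ω.edgeDir e ∈ ω.flowSpace :=
        sub_mem (flowProj_mem _) (Submodule.smul_mem _ _ (flowProj_mem _))
      rw [← inner_self_eq_zero (𝕜 := ℝ)]
      nth_rewrite 1 [sub_eq_add_neg]
      rw [inner_add_left, inner_neg_left, inner_smul_left, inner_edgeDir hmem,
        inner_edgeDir hmem, hx _ (mem_flowSpace.mp hmem)]
      simp
    rw [sub_eq_zero.mp h0]
    exact (Submodule.span_singleton_smul_eq (IsUnit.mk0 c hc) _).symm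

/-- A real flow that vanishes only where it is forced to by vanishing on `e`. -/
lemma exists_generic_realFlow (ω : G.Orientation) (e : E(G)) :
    ∃ w ∈ ω.realFlows, w e = 0 ∧ ∀ f, w f = 0 → ∀ x ∈ ω.realFlows, x e = 0 → x f = 0 := by
  classical
  let K : Submodule ℝ (E(G) → ℝ) := ω.realFlows ⊓ LinearMap.ker (LinearMap.proj e)
  let ι := {f : E(G) // ∃ x ∈ K, x f ≠ 0}
  -- Finitely many nonzero functionals on a real space are nonzero at a common vector.
  obtain ⟨w, hw, hwf⟩ := Module.Dual.exists_forall_mem_ne_zero_of_forall_exists K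
    (fun f : ι => (LinearMap.proj f.1 : (E(G) → ℝ) →ₗ[ℝ] ℝ)) (fun f => f.2)
  refine ⟨w, hw.1, hw.2, fun f hf x hx hxe => ?_⟩
  by_contra hxf
  exact hwf ⟨f, x, ⟨hx, hxe⟩, hxf⟩ hf

/-- Every projected coordinate vector is the direction of an edge of the Voronoi cell, which can be
chosen in any given circuit facet whose circuit avoids the coordinate. -/
lemma exists_voronoiEdge (hG : G.IsTwoEdgeConnected) (ω : G.Orientation) (e : E(G)) {x : E(G) → ℤ}
    (hx : x ∈ ω.flowLattice) (hx1 : ∀ f, |x f| ≤ 1) (hxe : x e = 0) :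
    ∃ ε, ω.IsVoronoiEdge ε ∧ vectorSpan ℝ ε = Submodule.span ℝ {ω.edgeDir e} ∧
      ε ⊆ ω.bisectorFace x := by
  obtain ⟨w, hw, hwe, hgen⟩ := ω.exists_generic_realFlow e
  have hx' := toEuclidean_mem_flowSpace hx
  -- `N` dominates `w`: on the support of `x`, the vector `w + N x` has the signs of `x`, so its
  -- face lies in the bisector face; elsewhere it equals `w`, so no new zeros appear.
  set N : ℝ := 1 + ∑ f, |w f| with hN
  have hlt : ∀ f, |w f| < N := by
    intro f
    have := Finset.single_le_sum (f := fun f => |w f|) (fun f _ => abs_nonneg _)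
      (Finset.mem_univ f)
    linarith
  have hx3 : ∀ f, x f = 0 ∨ x f = 1 ∨ x f = -1 := by
    intro f
    have := abs_le.mp (hx1 f)
    omega
  let w' : EuclideanSpace ℝ E(G) := WithLp.toLp 2 w + N • toEuclidean x
  have hw'f : ∀ f, w' f = w f + N * x f := fun f => rfl
  have hw' : w' ∈ ω.flowSpace :=
    add_mem (mem_flowSpace.mpr hw) (Submodule.smul_mem _ _ hx')
  have hzero : ∀ f, w' f = 0 → w f = 0 := by
    intro f hf
    rw [hw'f] at hf
    have h1 := abs_lt.mp (hlt f)
    rcases hx3 f with h | h | h <;> rw [h] at hf <;> push_cast at hf <;> linarith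
  have hspan : vectorSpan ℝ (ω.cellFace w') = Submodule.span ℝ {ω.edgeDir e} := by
    rw [vectorSpan_cellFace hw']
    apply le_antisymm
    · rw [Submodule.span_le]
      rintro _ ⟨f, hf, rfl⟩
      rw [(span_edgeDir_eq_iff hG).mpr (sameLine_of_forall hG (hgen f (hzero f hf)))]
      exact Submodule.mem_span_singleton_self _
    · rw [Submodule.span_singleton_le_iff_mem]
      refine Submodule.subset_span ⟨e, ?_, rfl⟩
      simp [hw'f, hwe, hxe]
  refine ⟨ω.cellFace w', ⟨cellFace_nonempty hw', isExposed_cellFace hw', ?_⟩, hspan, ?_⟩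
  · rw [hspan]
    exact finrank_span_singleton (edgeDir_ne_zero hG e)
  · intro p hp
    refine ⟨hp.1, ?_⟩
    obtain ⟨y, hy, hyw, rfl⟩ := (mem_cellFace_iff hw').mp hp
    rw [inner_flowProj hx', inner_eq_sum, inner_eq_sum, Finset.sum_div]
    refine Finset.sum_congr rfl fun f _ => ?_
    have h1 := abs_lt.mp (hlt f)
    have h2 := hyw f
    rw [hw'f] at h2
    simp only [toEuclidean_apply]
    rcases hx3 f with h | h | h
    · simp [h]
    · rw [h] at h2 ⊢
      push_cast at h2 ⊢
      rw [abs_of_pos (by linarith)] at h2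
      have : y f = 1 / 2 := mul_right_cancel₀ (b := w f + N * 1) (by linarith) (by linarith)
      rw [this]; norm_num
    · rw [h] at h2 ⊢
      push_cast at h2 ⊢
      rw [abs_of_neg (by linarith)] at h2
      have : y f = -(1 / 2) := mul_right_cancel₀ (b := w f + N * -1) (by linarith) (by linarith)
      rw [this]; norm_num

lemma exists_vectorSpan_eq (hG : G.IsTwoEdgeConnected) {ε : Set (EuclideanSpace ℝ E(G))}
    (hε : ω.IsVoronoiEdge ε) : ∃ e, vectorSpan ℝ ε = Submodule.span ℝ {ω.edgeDir e} := by
  obtain ⟨hne, hexp, hrank⟩ := hε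
  obtain ⟨w, hw, rfl⟩ := exists_eq_cellFace hne hexp
  have hspan := vectorSpan_cellFace hw
  obtain ⟨e, he⟩ : ∃ e, w e = 0 := by
    by_contra! h
    have : {e | w e = 0} = ∅ := by
      ext e
      simpa using h e
    rw [this, Set.image_empty, Submodule.span_empty] at hspan
    rw [hspan] at hrank
    simp at hrank
  refine ⟨e, (Submodule.eq_of_le_of_finrank_eq ?_ ?_).symm⟩
  · rw [hspan, Submodule.span_singleton_le_iff_mem]
    exact Submodule.subset_span ⟨e, he, rfl⟩
  · rw [hrank]
    exact finrank_span_singleton (edgeDir_ne_zero hG e)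

/-! ### Parallel classes and 2-cut blocks -/

lemma parallel_iff {ε ε' : Set (EuclideanSpace ℝ E(G))} (hε : ε.Nonempty) (hε' : ε'.Nonempty) :
    (affineSpan ℝ ε).Parallel (affineSpan ℝ ε') ↔ vectorSpan ℝ ε = vectorSpan ℝ ε' := by
  rw [AffineSubspace.parallel_iff_direction_eq_and_eq_bot_iff_eq_bot, direction_affineSpan,
    direction_affineSpan, affineSpan_eq_bot, affineSpan_eq_bot]
  simp [hε.ne_empty, hε'.ne_empty]

/-- Without cancellation, a flow vanishing on `e` decomposes into circuits vanishing on `e`. -/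
lemma forall_circuit_iff {e f : E(G)} :
    (∀ x : E(G) → ℤ, ω.IsCircuitElement x → x e = 0 → x f = 0) ↔
      ∀ x ∈ ω.realFlows, x e = 0 → x f = 0 := by
  constructor
  · intro h x hx
    refine conformal_induction (ω := ω) (P := fun w => w e = 0 → w f = 0) (fun _ => rfl)
      (fun w y a _ hy ha habs hP h0 => ?_) hx
    have h1 := habs e
    rw [show w e + a * y e = 0 from h0, abs_zero] at h1
    have h2 : 0 ≤ a * |(y e : ℝ)| := by positivity
    have h3 : w e = 0 := abs_eq_zero.mp (by linarith [abs_nonneg (w e)])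
    have h4 : a * |(y e : ℝ)| = 0 := by linarith [abs_nonneg (w e)]
    have h5 : y e = 0 := by
      rcases mul_eq_zero.mp h4 with h | h
      · exact absurd h ha.ne'
      · exact_mod_cast abs_eq_zero.mp h
    simp [hP h3, h y hy h5]
  · intro h x hx hxe
    have := h _ (cast_mem_realFlows_iff.mpr hx.mem_flowLattice) (by simp [hxe])
    exact_mod_cast this

/-- The parallel classes of edges of the Voronoi cell are the 2-cut blocks of the graph. -/
theorem exists_parallelClass_map (hG : G.IsTwoEdgeConnected) (ω : G.Orientation) :
    ∃ cls : E(G) → ω.ParallelClass, Function.Surjective cls ∧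
      (∀ e f, cls e = cls f ↔ ω.SameLine e f) ∧
      (∀ e, (cls e).block = {f | ω.SameLine e f}) ∧
      ∀ e (x : E(G) → ℤ), ω.IsCircuitElement x → ((cls e).Avoids x ↔ x e ≠ 0) := by
  have hex : ∀ e, ∃ ε, ω.IsVoronoiEdge ε ∧ vectorSpan ℝ ε = Submodule.span ℝ {ω.edgeDir e} := by
    intro e
    -- The bisector face of 0 is the whole cell, so this imposes no constraint.
    obtain ⟨ε, h1, h2, -⟩ := exists_voronoiEdge hG ω e (zero_mem ω.flowLattice) (by simp) rfl
    exact ⟨ε, h1, h2⟩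
  choose edge hedge hdir using hex
  let cls : E(G) → ω.ParallelClass := fun e => Quotient.mk ω.parallelSetoid ⟨edge e, hedge e⟩
  have hcls : ∀ e (ε : {ε // ω.IsVoronoiEdge ε}), Quotient.mk ω.parallelSetoid ε = cls e ↔
      vectorSpan ℝ ε.1 = Submodule.span ℝ {ω.edgeDir e} := by
    intro e ε
    rw [← hdir e, ← parallel_iff ε.2.1 (hedge e).1]
    exact Quotient.eq (r := ω.parallelSetoid)
  have havoid : ∀ e (x : E(G) → ℤ), ω.IsCircuitElement x → ((cls e).Avoids x ↔ x e ≠ 0) := by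
    intro e x hx
    constructor
    · intro h hxe
      obtain ⟨ε, h1, h2, h3⟩ := exists_voronoiEdge hG ω e hx.mem_flowLattice hx.abs_le_one hxe
      exact h ⟨ε, h1⟩ ((hcls e _).mpr h2) h3
    -- An edge inside the facet is orthogonal to `x`, but its direction pairs with `x` to `x e`.
    · intro hxe ε hε hsub
      rw [hcls] at hε
      have hx' := toEuclidean_mem_flowSpace hx.mem_flowLattice
      have hle : vectorSpan ℝ ε.1 ≤
          LinearMap.ker (innerSL ℝ (toEuclidean x)).toLinearMap := by
        rw [vectorSpan_def, Submodule.span_le]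
        rintro _ ⟨p, hp, q, hq, rfl⟩
        have h1 := (hsub hp).2
        have h2 := (hsub hq).2
        simp only [vsub_eq_sub, SetLike.mem_coe, LinearMap.mem_ker,
          ContinuousLinearMap.coe_coe, innerSL_apply_apply]
        rw [inner_sub_right, real_inner_comm p, h1, real_inner_comm q, h2, sub_self]
      have h1 : ω.edgeDir e ∈ vectorSpan ℝ ε.1 := by
        rw [hε]; exact Submodule.mem_span_singleton_self _
      have h2 : inner ℝ (toEuclidean x) (ω.edgeDir e) = 0 := hle h1
      rw [real_inner_comm, inner_edgeDir hx', toEuclidean_apply] at h2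
      exact hxe (by exact_mod_cast h2)
  refine ⟨cls, ?_, ?_, ?_, havoid⟩
  · intro c
    induction c using Quotient.inductionOn with
    | h ε =>
      obtain ⟨e, he⟩ := exists_vectorSpan_eq hG ε.2
      exact ⟨e, ((hcls e ε).mpr he).symm⟩
  · intro e f
    rw [← span_edgeDir_eq_iff hG, ← hdir e]
    exact hcls f ⟨edge e, hedge e⟩
  · intro e
    ext f
    have h1 : f ∈ (cls e).block ↔ ∀ x : E(G) → ℤ, ω.IsCircuitElement x → x e = 0 → x f = 0 := by
      refine forall₂_congr fun x hx => ?_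
      rw [havoid e x hx, not_not, Function.mem_support, not_not]
    rw [h1, forall_circuit_iff]
    exact ⟨fun h => sameLine_of_forall hG h, fun h x hx => (h x hx).mp⟩

/-! ### Linear independence of the absolute values -/

/-- The absolute values of coordinates on pairwise different 2-cut blocks are linearly independent
functions on the circuits. -/
theorem eq_zero_of_forall_circuit_sum_abs (hG : G.IsTwoEdgeConnected) {ι : Type*} [Fintype ι]
    {rep : ι → E(G)} (hrep : ∀ c d, ω.SameLine (rep c) (rep d) → c = d) {l : ι → ℝ}
    (h : ∀ x : E(G) → ℤ, ω.IsCircuitElement x → ∑ c, l c * |(x (rep c) : ℝ)| = 0) : l = 0 := by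
  classical
  have hflow : ∀ w ∈ ω.realFlows, ∑ c, l c * |w (rep c)| = 0 := by
    intro w hw
    refine conformal_induction (ω := ω) (P := fun w => ∑ c, l c * |w (rep c)| = 0) (by simp)
      (fun w y a _ hy ha habs hP => ?_) hw
    simp only [habs, mul_add, Finset.sum_add_distrib, hP, zero_add]
    have : ∀ c, l c * (a * |(y (rep c) : ℝ)|) = a * (l c * |(y (rep c) : ℝ)|) := fun c => by ring
    simp only [this, ← Finset.mul_sum, h y hy, mul_zero]
  funext c
  obtain ⟨w, hw, hwc, hgen⟩ := ω.exists_generic_realFlow (rep c)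
  obtain ⟨v, hv, hvc⟩ := exists_realFlow_eq_one hG ω (rep c)
  have hne : ∀ d, d ≠ c → w (rep d) ≠ 0 := fun d hd h0 =>
    hd (hrep c d (sameLine_of_forall hG (hgen _ h0))).symm
  obtain ⟨N, hN⟩ : ∃ N : ℝ, ∀ d, d ≠ c → |v (rep d)| ≤ |N * w (rep d)| := by
    refine ⟨∑ d, |v (rep d) / w (rep d)|, fun d hd => ?_⟩
    have h1 : |v (rep d) / w (rep d)| ≤ ∑ d, |v (rep d) / w (rep d)| :=
      Finset.single_le_sum (f := fun d => |v (rep d) / w (rep d)|) (fun _ _ => abs_nonneg _)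
        (Finset.mem_univ d)
    rw [abs_mul, abs_of_nonneg (le_trans (abs_nonneg _) h1)]
    rw [abs_div, div_le_iff₀ (abs_pos.mpr (hne d hd))] at h1
    exact h1
  have hNw := Submodule.smul_mem _ N hw
  have h1 := hflow _ (add_mem hNw hv)
  have h2 := hflow _ (sub_mem hNw hv)
  have h3 := hflow _ hNw
  -- A second difference at `N • w` in direction `v`: by the choice of `N` every term without a kink
  -- there cancels, leaving `2 * l c`.
  have h4 : ∑ d, (l d * |(N • w + v) (rep d)| + l d * |(N • w - v) (rep d)|
      - 2 * (l d * |(N • w) (rep d)|)) = 0 := by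
    rw [Finset.sum_sub_distrib, Finset.sum_add_distrib, ← Finset.mul_sum, h1, h2, h3]
    simp
  rw [Finset.sum_eq_single c] at h4
  · simp only [Pi.add_apply, Pi.sub_apply, Pi.smul_apply, smul_eq_mul, hwc, hvc] at h4
    norm_num at h4
    simpa using (by linarith : l c = 0)
  · intro d _ hd
    have habs : ∀ a b : ℝ, |b| ≤ |a| → |a + b| + |a - b| = 2 * |a| := by
      intro a b hab
      have hb := abs_le.mp hab
      rcases abs_cases a with ⟨h, h'⟩ | ⟨h, h'⟩
      · rw [h] at hb ⊢
        rw [abs_of_nonneg (by linarith), abs_of_nonneg (by linarith)]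
        ring
      · rw [h] at hb ⊢
        rw [abs_of_nonpos (by linarith), abs_of_nonpos (by linarith)]
        ring
    have := habs _ _ (hN d hd)
    simp only [Pi.add_apply, Pi.sub_apply, Pi.smul_apply, smul_eq_mul]
    rw [← mul_add, this]
    ring
  · simp

/-! ### Counting common edges and signs -/

lemma ncard_support_inter_eq {x y : E(G) → ℤ} (hx : ∀ e, |x e| ≤ 1) (hy : ∀ e, |y e| ≤ 1) :
    ((Function.support x ∩ Function.support y).ncard : ℤ) = ∑ e, |x e * y e| := by
  classical
  have h1 : Function.support x ∩ Function.support y =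
      ((Finset.univ.filter fun e => x e ≠ 0 ∧ y e ≠ 0 : Finset E(G)) : Set E(G)) := by
    ext e
    simp
  rw [h1, Set.ncard_coe_finset, Finset.card_filter]
  push_cast
  refine Finset.sum_congr rfl fun e _ => ?_
  have h2 := abs_le.mp (hx e)
  have h3 := abs_le.mp (hy e)
  have h4 : x e = 0 ∨ x e = 1 ∨ x e = -1 := by omega
  have h5 : y e = 0 ∨ y e = 1 ∨ y e = -1 := by omega
  rcases h4 with h4 | h4 | h4 <;> rcases h5 with h5 | h5 | h5 <;> simp [h4, h5]

/-- If there is no cancellation in the pairing, then all products have the same sign. -/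
lemma exists_sign_of_sum_abs_eq {x y : E(G) → ℤ} (h : ∑ e, |x e * y e| = |pairing x y|) :
    ∃ s : ℤ, ∀ e, x e * y e = s * |x e * y e| := by
  rcases le_total 0 (pairing x y) with h0 | h0
  · rw [abs_of_nonneg h0, pairing, eq_comm,
      Finset.sum_eq_sum_iff_of_le fun e _ => le_abs_self _] at h
    exact ⟨1, fun e => by rw [one_mul]; exact h e (Finset.mem_univ e)⟩
  · rw [abs_of_nonpos h0, pairing, ← Finset.sum_neg_distrib, eq_comm,
      Finset.sum_eq_sum_iff_of_le fun e _ => neg_le_abs _] at h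
    exact ⟨-1, fun e => by rw [← h e (Finset.mem_univ e)]; ring⟩

open Classical in
lemma finsum_cond_eq_sum {ι : Type*} [Fintype ι] (p : ι → Prop) (m : ι → ℤ) :
    (∑ᶠ (c : ι) (_ : p c), m c) = ∑ c, if p c then m c else 0 := by
  rw [finsum_eq_sum_of_fintype]
  exact Finset.sum_congr rfl fun c _ => finsum_eq_if

lemma sum_ite_ncard_fiber {ε ι : Type*} [Fintype ε] [Fintype ι] (f : ε → ι) (p : ι → Prop)
    [DecidablePred p] :
    (∑ c, if p c then (({e | f e = c} : Set ε).ncard : ℤ) else 0) =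
      ({e | p (f e)} : Set ε).ncard := by
  classical
  have h1 : ∀ q : ε → Prop, ({e | q e} : Set ε).ncard = (Finset.univ.filter q).card := by
    intro q
    rw [← Set.ncard_coe_finset]
    simp
  simp only [h1]
  rw [Finset.card_eq_sum_card_fiberwise (f := f) (t := Finset.univ) (by simp)]
  push_cast
  refine Finset.sum_congr rfl fun c _ => ?_
  split_ifs with hc
  · congr 2
    ext e
    simp only [Finset.mem_filter, Finset.mem_univ, true_and]
    exact ⟨fun h => ⟨h ▸ hc, h⟩, fun h => h.2⟩
  · symm
    rw [Nat.cast_eq_zero, Finset.card_eq_zero, Finset.filter_eq_empty_iff]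
    intro e he h
    simp only [Finset.mem_filter, Finset.mem_univ, true_and] at he
    exact hc (h ▸ he)

lemma pairing_self_nonneg (x : E(G) → ℤ) : 0 ≤ pairing x x :=
  Finset.sum_nonneg fun e _ => mul_self_nonneg (x e)

lemma sum_abs_mul_self (x : E(G) → ℤ) : ∑ e, |x e * x e| = |pairing x x| := by
  rw [abs_of_nonneg (pairing_self_nonneg x), pairing]
  exact Finset.sum_congr rfl fun e _ => abs_mul_self _

end Orientation

end Graph

/-! ### The bijection and the linear system -/

open Graph Graph.Orientation in
theorem mainTheorem3 {α β : Type*} (G : Graph α β) (hV : V(G).Finite) [Fintype E(G)]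
    (hG : G.IsTwoEdgeConnected) (ω : G.Orientation) {r : ℕ}
    (b : Module.Basis (Fin r) ℤ ω.flowLattice)
    (hb : Graph.Orientation.IsCircuitBasis b)
    (hfree : Graph.Orientation.IsCancellationFree b) :
    Finite ω.ParallelClass ∧
    Set.BijOn (fun c : ω.ParallelClass => c.block) Set.univ {S | G.IsTwoCutBlock S} ∧
    Graph.Orientation.IsPositiveSolution b (fun c => (c.block.ncard : ℤ)) ∧
    ∃! m : ω.ParallelClass → ℤ, Graph.Orientation.IsPositiveSolution b m := by
  classical
  obtain ⟨cls, hsurj, hcls, hblock, havoid⟩ := exists_parallelClass_map hG ω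
  have hfin : Finite ω.ParallelClass := Finite.of_surjective cls hsurj
  have := Fintype.ofFinite ω.ParallelClass
  have hblock' : ∀ c : ω.ParallelClass, c.block = {e | cls e = c} := by
    intro c
    obtain ⟨e, rfl⟩ := hsurj c
    rw [hblock]
    ext f
    exact (hcls e f).symm.trans eq_comm
  have hsum : ∀ i j, ∑ e, |(b i).1 e * (b j).1 e| = |pairing (b i).1 (b j).1| := by
    intro i j
    by_cases hij : i = j
    · rw [hij, sum_abs_mul_self]
    · rw [← hfree i j hij, ncard_support_inter_eq (hb i).abs_le_one (hb j).abs_le_one]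
  have hsol : Graph.Orientation.IsPositiveSolution b (fun c => (c.block.ncard : ℤ)) := by
    have key : ∀ i j, (∑ᶠ (c : ω.ParallelClass) (_ : c.Avoids (b i).1 ∧ c.Avoids (b j).1),
        (c.block.ncard : ℤ)) = |pairing (b i).1 (b j).1| := by
      intro i j
      rw [finsum_cond_eq_sum]
      simp only [hblock']
      rw [sum_ite_ncard_fiber cls fun c => c.Avoids (b i).1 ∧ c.Avoids (b j).1, ← hsum, ← ncard_support_inter_eq (hb i).abs_le_one
        (hb j).abs_le_one]
      congr 2
      ext e
      simp [havoid e _ (hb i), havoid e _ (hb j)]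
    refine ⟨fun c => ?_, fun i => ?_, fun i j _ => key i j⟩
    · obtain ⟨e, rfl⟩ := hsurj c
      rw [hblock', Nat.cast_pos, Set.ncard_pos]
      exact ⟨e, rfl⟩
    · rw [← abs_of_nonneg (pairing_self_nonneg (b i).1), ← key i i]
      simp only [and_self]
  refine ⟨hfin, ⟨?_, ?_, ?_⟩, hsol, _, hsol, ?_⟩
  · intro c _
    obtain ⟨e, rfl⟩ := hsurj c
    refine ⟨e, ?_⟩
    simp only [hblock, sameLine_iff hG]
  · intro c _ d _ h
    obtain ⟨e, rfl⟩ := hsurj c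
    have h1 : e ∈ (cls e).block := by
      rw [hblock']
      rfl
    rw [show (cls e).block = d.block from h] at h1
    rw [hblock'] at h1
    exact h1
  · rintro S ⟨e, rfl⟩
    refine ⟨cls e, trivial, ?_⟩
    simp only [hblock, sameLine_iff hG]
  · intro m hm
    let m' : ω.ParallelClass → ℤ := fun c => (c.block.ncard : ℤ)
    change m = m'
    let rep : ω.ParallelClass → E(G) := Function.surjInv hsurj
    have hrep : ∀ c, cls (rep c) = c := Function.surjInv_eq hsurj
    have hav : ∀ c i, c.Avoids (b i).1 ↔ (b i).1 (rep c) ≠ 0 := by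
      intro c i
      rw [← havoid (rep c) _ (hb i), hrep]
    have hval : ∀ m : ω.ParallelClass → ℤ, IsPositiveSolution b m → ∀ i j,
        ∑ c, m c * |(b i).1 (rep c) * (b j).1 (rep c)| = |pairing (b i).1 (b j).1| := by
      intro m hm i j
      have h1 : (∑ᶠ (c : ω.ParallelClass) (_ : c.Avoids (b i).1 ∧ c.Avoids (b j).1), m c)
          = |pairing (b i).1 (b j).1| := by
        by_cases hij : i = j
        · subst hij
          simp only [and_self]
          rw [hm.length, abs_of_nonneg (pairing_self_nonneg _)]
        · exact hm.intersect i j hij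
      rw [← h1, finsum_cond_eq_sum]
      refine Finset.sum_congr rfl fun c _ => ?_
      rw [hav, hav]
      have h2 := abs_le.mp ((hb i).abs_le_one (rep c))
      have h3 := abs_le.mp ((hb j).abs_le_one (rep c))
      have h4 : (b i).1 (rep c) = 0 ∨ (b i).1 (rep c) = 1 ∨ (b i).1 (rep c) = -1 := by omega
      have h5 : (b j).1 (rep c) = 0 ∨ (b j).1 (rep c) = 1 ∨ (b j).1 (rep c) = -1 := by omega
      rcases h4 with h4 | h4 | h4 <;> rcases h5 with h5 | h5 | h5 <;> simp [h4, h5]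
    -- Dropping the absolute values makes the equations bilinear, so vanishing on basis pairs
    -- extends to all flows.
    let D : LinearMap.BilinForm ℤ ω.flowLattice := LinearMap.mk₂ ℤ
      (fun x y => ∑ c, (m c - m' c) * (x.1 (rep c) * y.1 (rep c)))
      (fun x x' y => by
        rw [← Finset.sum_add_distrib]
        exact Finset.sum_congr rfl fun c _ => by
          simp only [Submodule.coe_add, Pi.add_apply]; ring)
      (fun a x y => by
        rw [smul_eq_mul, Finset.mul_sum]
        exact Finset.sum_congr rfl fun c _ => by
          simp only [Submodule.coe_smul, Pi.smul_apply, smul_eq_mul]; ring)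
      (fun x y y' => by
        rw [← Finset.sum_add_distrib]
        exact Finset.sum_congr rfl fun c _ => by
          simp only [Submodule.coe_add, Pi.add_apply]; ring)
      (fun a x y => by
        rw [smul_eq_mul, Finset.mul_sum]
        exact Finset.sum_congr rfl fun c _ => by
          simp only [Submodule.coe_smul, Pi.smul_apply, smul_eq_mul]; ring)
    have hD : D = 0 := by
      refine LinearMap.BilinForm.ext_basis b fun i j => ?_
      -- One sign `s` serves all coordinates, which turns the products back into the absolute values
      -- of the system.
      obtain ⟨s, hs⟩ := exists_sign_of_sum_abs_eq (hsum i j)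
      change ∑ c, (m c - m' c) * ((b i).1 (rep c) * (b j).1 (rep c)) = 0
      have h1 : ∀ c, (m c - m' c) * ((b i).1 (rep c) * (b j).1 (rep c)) =
          s * (m c * |(b i).1 (rep c) * (b j).1 (rep c)|
            - m' c * |(b i).1 (rep c) * (b j).1 (rep c)|) := by
        intro c
        linear_combination (m c - m' c) * hs (rep c)
      simp only [h1, ← Finset.mul_sum, Finset.sum_sub_distrib]
      rw [hval m hm, hval m' hsol, sub_self, mul_zero]
    have hzero := eq_zero_of_forall_circuit_sum_abs hG (ω := ω) (rep := rep)
      (l := fun c => ((m c - m' c : ℤ) : ℝ))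
      (fun c d h => by rw [← hrep c, ← hrep d, hcls]; exact h)
      (fun x hx => by
        have h1 : D ⟨x, hx.mem_flowLattice⟩ ⟨x, hx.mem_flowLattice⟩ = 0 := by
          rw [hD]; rfl
        have h2 : ∑ c, (m c - m' c) * (x (rep c) * x (rep c)) = 0 := h1
        -- On a circuit the coefficients are 0 or ±1, so squares equal absolute values.
        have h3 : ∑ c, (m c - m' c) * |x (rep c)| = 0 := by
          rw [← h2]
          refine Finset.sum_congr rfl fun c _ => ?_
          have h4 := abs_le.mp (hx.abs_le_one (rep c))
          have h5 : x (rep c) = 0 ∨ x (rep c) = 1 ∨ x (rep c) = -1 := by omega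
          rcases h5 with h5 | h5 | h5 <;> simp [h5]
        exact_mod_cast h3)
    funext c
    have h1 : ((m c - m' c : ℤ) : ℝ) = 0 := congrFun hzero c
    have h2 : m c - m' c = 0 := by exact_mod_cast h1
    linarith
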